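/- Let $\mathbb P$ be a set of atomic propositions and $\mathbb A$ a set of agents, and let $\mathcal L^*$ be the language with formulas $\varphi,\psi ::= p \mid \neg\varphi \mid \varphi\wedge\psi \mid \langle\alpha\rangle\varphi$ and programs $\alpha,\beta ::= a \mid \alpha;\beta \mid \alpha\cup\beta \mid \alpha^*$, where $p\in\mathbb P$ and $a\in\mathbb A$. A polytopological closure model is a set $X$ with a topology $\mathcal T_a$ on $X$, with closure operator $c_a$, for each $a\in\mathbb A$, and a valuation $[\![\cdot]\!]:\mathbb P\to 2^X$. Programs denote operators $2^X\to 2^X$ by $[\![a]\!](Y)=c_a(Y)$, $[\![\alpha;\beta]\!](Y)=[\![\alpha]\!]([\![\beta]\!](Y))$, $[\![\alpha\cup\beta]\!](Y)=[\![\alpha]\!](Y)\cup[\![\beta]\!](Y)$ and $[\![\alpha^*]\!](Y)=\bigcap\{Z\subseteq X : [\![\alpha]\!](Z)\cup Y\subseteq Z\}$. Truth sets of formulas are defined as usual for $\neg$ and $\wedge$, with $[\![\langle\alpha\rangle\varphi]\!]=[\![\alpha]\!]([\![\varphi]\!])$. A formula is satisfied in a model if its truth set is non-empty, and it is valid if its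 truth set is all of $X$ in every polytopological closure model. **Theorem.** $\mathcal L^*$ has the effective finite model property over polytopological closure spaces: there is a computable function $f:\mathbb N\to\mathbb N$ such that every formula $\varphi$ that is satisfied in some polytopological closure model is satisfied in a polytopological closure model with at most $f(|\varphi|)$ points, where $|\varphi|$ is the length (number of symbols) of $\varphi$. Moreover, if $\mathbb P$ and $\mathbb A$ are effectively (primitive recursively) encoded by natural numbers, then the validity problem is decidable: there is an algorithm which decides whether a given word is a formula of $\mathcal L^*$ that is valid over polytopological closure spaces. -/

import Mathlib

universe u v w

namespace TopPDL

/-- Programs over a set `A` of agents (atomic programs). -/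
inductive Program (A : Type v) : Type v
  | atom (a : A) : Program A
  | comp (α β : Program A) : Program A
  | union (α β : Program A) : Program A
  | star (α : Program A) : Program A

/-- Formulas of the language over atomic propositions `P` and agents `A`. -/
inductive Formula (P : Type u) (A : Type v) : Type (max u v)
  | prop (p : P) : Formula P A
  | neg (φ : Formula P A) : Formula P A
  | and (φ ψ : Formula P A) : Formula P A
  | dia (α : Program A) (φ : Formula P A) : Formula P A

/-- The logical symbols. -/
inductive Connective : Type
  | neg | and | dia | comp | union | star

def Connective.equivFin : Connective ≃ Fin 6 where
  toFun
    | .neg => 0 | .and => 1 | .dia => 2 | .comp => 3 | .union => 4 | .star => 5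
  invFun
    | 0 => .neg | 1 => .and | 2 => .dia | 3 => .comp | 4 => .union | 5 => .star
  left_inv c := by cases c <;> rfl
  right_inv i := by fin_cases i <;> rfl

instance : Primcodable Connective := Primcodable.ofEquiv (Fin 6) Connective.equivFin

/-- The alphabet in which formulas are written. -/
abbrev Symb (P : Type u) (A : Type v) : Type (max u v) := P ⊕ A ⊕ Connective

/-- A program written as a word, in prefix (Polish) notation. -/
def Program.word (P : Type u) {A : Type v} : Program A → List (Symb P A)
  | .atom a => [.inr (.inl a)]
  | .comp α β => .inr (.inr .comp) :: (α.word P ++ β.word P)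
  | .union α β => .inr (.inr .union) :: (α.word P ++ β.word P)
  | .star α => .inr (.inr .star) :: α.word P

/-- A formula written as a word, in prefix (Polish) notation. -/
def Formula.word {P : Type u} {A : Type v} : Formula P A → List (Symb P A)
  | .prop p => [.inl p]
  | .neg φ => .inr (.inr .neg) :: φ.word
  | .and φ ψ => .inr (.inr .and) :: (φ.word ++ ψ.word)
  | .dia α φ => .inr (.inr .dia) :: (α.word P ++ φ.word)

/-- The length of a formula: the number of its symbols. -/
def Formula.length {P : Type u} {A : Type v} (φ : Formula P A) : ℕ := φ.word.length

theorem Program.word_append_inj (P : Type u) {A : Type v} (α β : Program A)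
    (s t : List (Symb P A)) (h : α.word P ++ s = β.word P ++ t) : α = β ∧ s = t := by
  induction α generalizing β s t with
  | atom a => cases β <;> simp_all [Program.word]
  | comp α₁ α₂ ih₁ ih₂ =>
    cases β <;> simp [Program.word] at h
    obtain ⟨rfl, h'⟩ := ih₁ _ _ _ h
    obtain ⟨rfl, h''⟩ := ih₂ _ _ _ h'
    exact ⟨rfl, h''⟩
  | union α₁ α₂ ih₁ ih₂ =>
    cases β <;> simp [Program.word] at h
    obtain ⟨rfl, h'⟩ := ih₁ _ _ _ h
    obtain ⟨rfl, h''⟩ := ih₂ _ _ _ h'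
    exact ⟨rfl, h''⟩
  | star α ih =>
    cases β <;> simp [Program.word] at h
    obtain ⟨rfl, h'⟩ := ih _ _ _ h
    exact ⟨rfl, h'⟩

theorem Formula.word_append_inj {P : Type u} {A : Type v} (φ ψ : Formula P A)
    (s t : List (Symb P A)) (h : φ.word ++ s = ψ.word ++ t) : φ = ψ ∧ s = t := by
  induction φ generalizing ψ s t with
  | prop p => cases ψ <;> simp_all [Formula.word]
  | neg φ ih =>
    cases ψ <;> simp [Formula.word] at h
    obtain ⟨rfl, h'⟩ := ih _ _ _ h
    exact ⟨rfl, h'⟩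
  | and φ₁ φ₂ ih₁ ih₂ =>
    cases ψ <;> simp [Formula.word] at h
    obtain ⟨rfl, h'⟩ := ih₁ _ _ _ h
    obtain ⟨rfl, h''⟩ := ih₂ _ _ _ h'
    exact ⟨rfl, h''⟩
  | dia α φ ih =>
    cases ψ <;> simp [Formula.word] at h
    obtain ⟨rfl, h'⟩ := Program.word_append_inj P _ _ _ _ h
    obtain ⟨rfl, h''⟩ := ih _ _ _ h'
    exact ⟨rfl, h''⟩

/-- Unique readability: distinct formulas are distinct words. -/
theorem Formula.word_injective {P : Type u} {A : Type v} :
    Function.Injective (Formula.word : Formula P A → List (Symb P A)) := fun φ ψ h =>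
  (Formula.word_append_inj φ ψ [] [] (by rw [h])).1

/-- `d` is a derivative operator on the set `X`. -/
structure IsDerivative {X : Type w} (d : Set X → Set X) : Prop where
  map_empty : d ∅ = ∅
  map_union : ∀ B C : Set X, d (B ∪ C) = d B ∪ d C
  weakly_idempotent : ∀ B : Set X, d (d B) ⊆ B ∪ d B

/-- A polyderivative model: a set of points, a derivative operator for each agent, and a
valuation of the atomic propositions. -/
structure PolyderivativeModel (P : Type u) (A : Type v) : Type (max u v (w + 1)) where
  X : Type w
  d : A → Set X → Set X
  isDerivative : ∀ a, IsDerivative (d a)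
  val : P → Set X

namespace PolyderivativeModel

variable {P : Type u} {A : Type v}

/-- The operator on sets of points assigned to a program. -/
def programOp (M : PolyderivativeModel.{u, v, w} P A) : Program A → Set M.X → Set M.X
  | .atom a, Y => M.d a Y
  | .comp α β, Y => M.programOp α (M.programOp β Y)
  | .union α β, Y => M.programOp α Y ∪ M.programOp β Y
  | .star α, Y => ⋂₀ {Z | M.programOp α Z ∪ Y ⊆ Z}

/-- The truth set of a formula. -/
def truthSet (M : PolyderivativeModel.{u, v, w} P A) : Formula P A → Set M.X
  | .prop p => M.val p
  | .neg φ => (M.truthSet φ)ᶜ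
  | .and φ ψ => M.truthSet φ ∩ M.truthSet ψ
  | .dia α φ => M.programOp α (M.truthSet φ)

/-- The operator of each agent `a` is the closure operator of some topology `T a`. -/
def IsPolytopologicalClosure (M : PolyderivativeModel.{u, v, w} P A) : Prop :=
  ∃ T : A → TopologicalSpace M.X, ∀ a (Y : Set M.X), M.d a Y = @closure M.X (T a) Y

end PolyderivativeModel

/-- Effective finite model property over polytopological closure spaces. -/
def EffectiveFMP (P : Type u) (A : Type v) : Prop :=
  ∃ f : ℕ → ℕ, Computable f ∧ ∀ φ : Formula P A,
    (∃ M : PolyderivativeModel.{u, v, w} P A,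
      M.IsPolytopologicalClosure ∧ ∃ x : M.X, x ∈ M.truthSet φ) →
    ∃ M : PolyderivativeModel.{u, v, w} P A,
      M.IsPolytopologicalClosure ∧ Finite M.X ∧ Nat.card M.X ≤ f φ.length ∧
        ∃ x : M.X, x ∈ M.truthSet φ

/-- `φ` is valid over polytopological closure spaces. -/
def Valid {P : Type u} {A : Type v} (φ : Formula P A) : Prop :=
  ∀ M : PolyderivativeModel.{u, v, w} P A,
    M.IsPolytopologicalClosure → ∀ x : M.X, x ∈ M.truthSet φ

/-- The set of words that are valid formulas is a decidable set of words. -/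
def ValidityDecidable (P : Type u) (A : Type v) [Primcodable P] [Primcodable A] : Prop :=
  ComputablePred fun s : List (Symb P A) => ∃ φ : Formula P A, φ.word = s ∧ Valid.{u, v, w} φ

end TopPDL

/-! A filtration argument works although the spaces need not be Alexandrov. Program operators
preserve finite unions: this holds for closures and passes through composition, union and least
fixed points. Identify points that agree on the Fischer–Ladner closure of `φ`; this closure has at
most `|φ|` members, so there are at most `2 ^ |φ|` cells. Put `q → r` for an agent `a` if the cell
of `q` meets the `a`-closure of the cell of `r`, and pass to the reflexive transitive closure.

Two inductions on programs give the truth lemma. If `x` lies in `α` of the cell of `r`, then `α`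
leads from the class of `x` to `r` (`kripkeRel_filtrationRel_of_mem`); by finite additivity every
witness of a diamond lies in a single cell. Conversely, if `α` leads from `q` to `r` and `ψ` holds
on the cell of `r`, then `⟨α⟩ψ` holds on the cell of `q` (`mem_truthSet_dia_of_kripkeRel`); here
idempotence of closure pays for the transitive closure. The resulting finite preorders are again
topological models, through their up-sets.

For decidability, `φ` is valid iff `¬φ` has no preorder model with at most `2 ^ (|φ| + 1)` points.
Such models, restricted to the symbols of `φ`, are the bits of bounded numbers, and a stack machine
reading the Polish word from the right evaluates `φ` in them primitive recursively. -/

namespace TopPDL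

open Relation

/-! ### Preorders as topological models -/

/-- The accessibility relation of a program over atomic accessibility relations `R`. -/
def kripkeRel {A : Type v} {X : Type w} (R : A → X → X → Prop) : Program A → X → X → Prop
  | .atom a => R a
  | .comp α β => fun x z => ∃ y, kripkeRel R α x y ∧ kripkeRel R β y z
  | .union α β => fun x y => kripkeRel R α x y ∨ kripkeRel R β x y
  | .star α => ReflTransGen (kripkeRel R α)

/-- Satisfaction in a relational model. -/
def kripkeSat {P : Type u} {A : Type v} {X : Type w} (R : A → X → X → Prop)
    (V : P → X → Prop) : Formula P A → X → Prop
  | .prop p => V p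
  | .neg φ => fun x => ¬ kripkeSat R V φ x
  | .and φ ψ => fun x => kripkeSat R V φ x ∧ kripkeSat R V ψ x
  | .dia α φ => fun x => ∃ y, kripkeRel R α x y ∧ kripkeSat R V φ y

/-- The topology whose open sets are the sets closed under a relation. -/
abbrev upsetTopology {X : Type w} (r : X → X → Prop) : TopologicalSpace X where
  IsOpen U := ∀ x ∈ U, ∀ y, r x y → y ∈ U
  isOpen_univ _ _ _ _ := trivial
  isOpen_inter _ _ hU hV x hx y hxy := ⟨hU x hx.1 y hxy, hV x hx.2 y hxy⟩
  isOpen_sUnion _ h x := fun ⟨U, hU, hx⟩ y hxy => ⟨U, hU, h U hU x hx y hxy⟩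

/-- Transitivity makes the complement of the right-hand side an up-set, and reflexivity puts `Y`
inside it; every open set around `x` contains all successors of `x`. -/
theorem closure_upsetTopology {X : Type w} {r : X → X → Prop} (hr : ∀ x, r x x)
    (ht : ∀ x y z, r x y → r y z → r x z) (Y : Set X) :
    @closure X (upsetTopology r) Y = {x | ∃ y ∈ Y, r x y} := by
  let := upsetTopology r
  apply Set.Subset.antisymm
  · refine closure_minimal (fun y hy => ⟨y, hy, hr y⟩) ⟨?_⟩
    intro x hx y hxy ⟨z, hz, hyz⟩
    exact hx ⟨z, hz, ht _ _ _ hxy hyz⟩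
  · rintro x ⟨y, hy, hxy⟩
    refine mem_closure_iff.2 fun U hU hx => ⟨y, ?_, hy⟩
    exact hU x hx y hxy

theorem isDerivative_closure {X : Type w} (T : TopologicalSpace X) :
    IsDerivative (fun Y : Set X => closure Y) where
  map_empty := closure_empty
  map_union _ _ := closure_union
  weakly_idempotent B := by simp

/-- The polytopological model of a family of preorders. -/
def kripkeModel {P : Type u} {A : Type v} {X : Type w} (R : A → X → X → Prop)
    (V : P → X → Prop) : PolyderivativeModel.{u, v, w} P A where
  X := X
  d a Y := @closure X (upsetTopology (R a)) Y
  isDerivative a := isDerivative_closure (upsetTopology (R a))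
  val p := {x | V p x}

theorem isPolytopologicalClosure_kripkeModel {P : Type u} {A : Type v} {X : Type w}
    (R : A → X → X → Prop) (V : P → X → Prop) :
    (kripkeModel R V).IsPolytopologicalClosure :=
  ⟨fun a => upsetTopology (R a), fun _ _ => rfl⟩

section Kripke

variable {P : Type u} {A : Type v} {X : Type w} {R : A → X → X → Prop} {V : P → X → Prop}

theorem programOp_kripkeModel (hr : ∀ a x, R a x x) (ht : ∀ a x y z, R a x y → R a y z → R a x z)
    (α : Program A) (Y : Set X) :
    (kripkeModel R V).programOp α Y = {x | ∃ y ∈ Y, kripkeRel R α x y} := by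
  induction α generalizing Y with
  | atom a => exact closure_upsetTopology (hr a) (ht a) Y
  | comp α β ihα ihβ =>
    ext x
    simp only [PolyderivativeModel.programOp, ihα, ihβ, kripkeRel]
    constructor
    · rintro ⟨y, ⟨z, hz, hyz⟩, hxy⟩
      exact ⟨z, hz, y, hxy, hyz⟩
    · rintro ⟨z, hz, y, hxy, hyz⟩
      exact ⟨y, ⟨z, hz, hyz⟩, hxy⟩
  | union α β ihα ihβ =>
    ext x
    simp only [PolyderivativeModel.programOp, ihα, ihβ, kripkeRel]
    constructor
    · rintro (⟨y, hy, h⟩ | ⟨y, hy, h⟩)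
      · exact ⟨y, hy, Or.inl h⟩
      · exact ⟨y, hy, Or.inr h⟩
    · rintro ⟨y, hy, h | h⟩
      · exact Or.inl ⟨y, hy, h⟩
      · exact Or.inr ⟨y, hy, h⟩
  | star α ih =>
    apply Set.Subset.antisymm
    · refine Set.sInter_subset_of_mem ?_
      rintro x (hx | hx)
      · rw [ih] at hx
        obtain ⟨y, ⟨z, hz, hyz⟩, hxy⟩ := hx
        exact ⟨z, hz, ReflTransGen.head hxy hyz⟩
      · exact ⟨x, hx, ReflTransGen.refl⟩
    · rintro x ⟨y, hy, hxy⟩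
      -- Membership in a set `Z` closed under `α` travels backwards along the path from `y`.
      refine Set.mem_sInter.2 fun Z hZ => ?_
      induction hxy using ReflTransGen.head_induction_on with
      | refl => exact hZ (Or.inr hy)
      | head h _ ih' =>
        exact hZ (Or.inl ((Set.ext_iff.1 (ih Z) _).2 ⟨_, ih', h⟩))

theorem mem_truthSet_kripkeModel (hr : ∀ a x, R a x x)
    (ht : ∀ a x y z, R a x y → R a y z → R a x z) (φ : Formula P A) (x : X) :
    x ∈ (kripkeModel R V).truthSet φ ↔ kripkeSat R V φ x := by
  induction φ generalizing x with
  | prop p => rfl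
  | neg φ ih => exact not_congr (ih x)
  | and φ ψ ihφ ihψ => exact and_congr (ihφ x) (ihψ x)
  | dia α φ ih =>
    refine (Set.ext_iff.1 (programOp_kripkeModel hr ht α _) x).trans (exists_congr fun y => ?_)
    exact (and_congr_left' (ih y)).trans and_comm

end Kripke

/-! ### Finite additivity of program operators -/

namespace PolyderivativeModel

variable {P : Type u} {A : Type v} (M : PolyderivativeModel.{u, v, w} P A)

theorem subset_programOp_star (α : Program A) (Y : Set M.X) : Y ⊆ M.programOp (.star α) Y :=
  fun _ hx => Set.mem_sInter.2 fun _ hZ => hZ (Or.inr hx)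

theorem programOp_star_subset {α : Program A} {Y Z : Set M.X} (hα : M.programOp α Z ⊆ Z)
    (hY : Y ⊆ Z) : M.programOp (.star α) Y ⊆ Z :=
  Set.sInter_subset_of_mem (Set.union_subset hα hY)

theorem programOp_mono (α : Program A) : Monotone (M.programOp α) := by
  induction α with
  | atom a =>
    intro Y Z h
    change M.d a Y ⊆ M.d a Z
    rw [← Set.union_eq_right.2 h, (M.isDerivative a).map_union]
    exact Set.subset_union_left
  | comp α β ihα ihβ => exact fun Y Z h => ihα (ihβ h)
  | union α β ihα ihβ => exact fun Y Z h => Set.union_subset_union (ihα h) (ihβ h)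
  | star α ih =>
    intro Y Z h
    exact Set.sInter_subset_sInter fun W hW => (Set.union_subset_union_right _ h).trans hW

theorem programOp_programOp_star_subset (α : Program A) (Y : Set M.X) :
    M.programOp α (M.programOp (.star α) Y) ⊆ M.programOp (.star α) Y := by
  intro x hx
  refine Set.mem_sInter.2 fun Z hZ => hZ (Or.inl ?_)
  exact M.programOp_mono α (Set.sInter_subset_of_mem hZ) hx

theorem programOp_empty (α : Program A) : M.programOp α ∅ = ∅ := by
  induction α with
  | atom a => exact (M.isDerivative a).map_empty
  | comp α β ihα ihβ => simp [programOp, ihα, ihβ]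
  | union α β ihα ihβ => simp [programOp, ihα, ihβ]
  | star α ih => exact Set.subset_empty_iff.1 (M.programOp_star_subset ih.subset subset_rfl)

theorem programOp_union (α : Program A) (Y Z : Set M.X) :
    M.programOp α (Y ∪ Z) = M.programOp α Y ∪ M.programOp α Z := by
  induction α generalizing Y Z with
  | atom a => exact (M.isDerivative a).map_union Y Z
  | comp α β ihα ihβ => simp [programOp, ihα, ihβ]
  | union α β ihα ihβ =>
    simp only [programOp, ihα, ihβ]
    exact Set.union_union_union_comm _ _ _ _
  | star α ih =>
    apply Set.Subset.antisymm
    -- By additivity of `α`, the union of the two iterates is itself closed under `α`, so it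
    -- contains the least such set.
    · refine M.programOp_star_subset ?_ (Set.union_subset_union
        (M.subset_programOp_star α Y) (M.subset_programOp_star α Z))
      rw [ih]
      exact Set.union_subset_union (M.programOp_programOp_star_subset α Y)
        (M.programOp_programOp_star_subset α Z)
    · exact Set.union_subset (M.programOp_mono _ Set.subset_union_left)
        (M.programOp_mono _ Set.subset_union_right)

theorem programOp_iUnion {ι : Type*} [Finite ι] (α : Program A) (Y : ι → Set M.X) :
    M.programOp α (⋃ i, Y i) = ⋃ i, M.programOp α (Y i) := by
  classical
  cases nonempty_fintype ι
  have key (s : Finset ι) : M.programOp α (⋃ i ∈ s, Y i) = ⋃ i ∈ s, M.programOp α (Y i) := by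
    induction s using Finset.induction_on with
    | empty => simp [programOp_empty]
    | insert i s _ ih => simp only [Finset.set_biUnion_insert, programOp_union, ih]
  simpa using key Finset.univ

/-! ### Filtration -/

/-- Agreement of points on a list of formulas. -/
def agreeOn (S : List (Formula P A)) : Setoid M.X where
  r x y := ∀ ψ ∈ S, x ∈ M.truthSet ψ ↔ y ∈ M.truthSet ψ
  iseqv := ⟨fun _ _ _ => Iff.rfl, fun h ψ hψ => (h ψ hψ).symm,
    fun h h' ψ hψ => (h ψ hψ).trans (h' ψ hψ)⟩

/-- The points of the filtration of `M` through a list of formulas. -/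
abbrev Filtration (S : List (Formula P A)) : Type w := Quotient (M.agreeOn S)

variable (S : List (Formula P A))

/-- Truth of a formula of the list at a point of the filtration. -/
def typeOf (q : M.Filtration S) (i : Fin S.length) : Prop :=
  Quotient.liftOn q (fun x => x ∈ M.truthSet (S.get i)) fun _ _ h =>
    propext (h _ (S.get_mem i))

theorem typeOf_injective : Function.Injective (M.typeOf S) := by
  rintro ⟨x⟩ ⟨y⟩ h
  refine Quotient.sound fun ψ hψ => ?_
  obtain ⟨i, rfl⟩ := List.get_of_mem hψ
  exact iff_of_eq (congrFun h i)

instance finite_filtration : Finite (M.Filtration S) :=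
  Finite.of_injective _ (M.typeOf_injective S)

theorem card_filtration_le : Nat.card (M.Filtration S) ≤ 2 ^ S.length := by
  refine (Nat.card_le_card_of_injective _ (M.typeOf_injective S)).trans ?_
  simp

/-- The set of points of `M` represented by a point of the filtration. -/
def cell (q : M.Filtration S) : Set M.X := {x | (⟦x⟧ : M.Filtration S) = q}

/-- The accessibility relations of the filtration. -/
def filtrationRel (a : A) : M.Filtration S → M.Filtration S → Prop :=
  ReflTransGen fun q r => (M.cell S q ∩ M.d a (M.cell S r)).Nonempty

theorem iUnion_inter_cell (Y : Set M.X) : ⋃ q, (Y ∩ M.cell S q) = Y := by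
  ext x
  simp [cell]

/-- This half uses only finite additivity and preservation of `∅`, so `S` is arbitrary and no
topology is needed. -/
theorem kripkeRel_filtrationRel_of_mem (α : Program A) {x : M.X} {r : M.Filtration S}
    (hx : x ∈ M.programOp α (M.cell S r)) :
    kripkeRel (M.filtrationRel S) α ⟦x⟧ r := by
  induction α generalizing x r with
  | atom a => exact ReflTransGen.single ⟨x, rfl, hx⟩
  | comp α β ihα ihβ =>
    change x ∈ M.programOp α (M.programOp β (M.cell S r)) at hx
    -- Finitely many cells: one of them already accounts for `x`, and its part inside the `β`-image
    -- is nonempty because operators preserve `∅`.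
    rw [← M.iUnion_inter_cell S (M.programOp β _), programOp_iUnion] at hx
    obtain ⟨q, hq⟩ := Set.mem_iUnion.1 hx
    refine ⟨q, ihα (M.programOp_mono α Set.inter_subset_right hq), ?_⟩
    have hne : (M.programOp β (M.cell S r) ∩ M.cell S q).Nonempty := by
      rw [Set.nonempty_iff_ne_empty]
      intro h
      rw [h, programOp_empty] at hq
      exact hq
    obtain ⟨y, hy, rfl⟩ := hne
    exact ihβ hy
  | union α β ihα ihβ => exact hx.imp ihα ihβ
  | star α ih =>
    -- Fixed point induction with the set of points whose class reaches `r`.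
    refine M.programOp_star_subset
      (Z := {y | ReflTransGen (kripkeRel (M.filtrationRel S) α) ⟦y⟧ r}) ?_ ?_ hx
    · intro y hy
      rw [← M.iUnion_inter_cell S {y | ReflTransGen _ _ _}, programOp_iUnion] at hy
      obtain ⟨q, hq⟩ := Set.mem_iUnion.1 hy
      refine ReflTransGen.head (ih (M.programOp_mono α Set.inter_subset_right hq)) ?_
      by_contra hqr
      have hempty : {y | ReflTransGen (kripkeRel (M.filtrationRel S) α) ⟦y⟧ r} ∩ M.cell S q = ∅ := by
        rw [Set.eq_empty_iff_forall_notMem]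
        rintro z ⟨hz, rfl⟩
        exact hqr hz
      rw [hempty, programOp_empty] at hq
      exact hq
    · rintro y rfl
      exact ReflTransGen.refl

end PolyderivativeModel

/-! ### Fischer–Ladner closure -/

/-- The formulas `⟨β⟩χ` arising from unfolding `⟨α⟩ψ`. -/
def Program.unfoldings {P : Type u} {A : Type v} : Program A → Formula P A → List (Formula P A)
  | .atom a, ψ => [.dia (.atom a) ψ]
  | .comp α β, ψ => .dia (.comp α β) ψ :: (α.unfoldings (.dia β ψ) ++ β.unfoldings ψ)
  | .union α β, ψ => .dia (.union α β) ψ :: (α.unfoldings ψ ++ β.unfoldings ψ)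
  | .star α, ψ => .dia (.star α) ψ :: α.unfoldings (.dia (.star α) ψ)

/-- The Fischer–Ladner closure (up to negation). -/
def Formula.fischerLadner {P : Type u} {A : Type v} : Formula P A → List (Formula P A)
  | .prop p => [.prop p]
  | .neg φ => .neg φ :: φ.fischerLadner
  | .and φ ψ => .and φ ψ :: (φ.fischerLadner ++ ψ.fischerLadner)
  | .dia α φ => α.unfoldings φ ++ φ.fischerLadner

section FischerLadner

variable {P : Type u} {A : Type v}

/-- Each symbol of the program contributes exactly one unfolding, repetitions counted. -/
theorem Program.length_unfoldings (α : Program A) (ψ : Formula P A) :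
    (α.unfoldings ψ).length = (α.word P).length := by
  induction α generalizing ψ with
  | atom a => rfl
  | comp α β ihα ihβ => simp [unfoldings, word, ihα, ihβ]
  | union α β ihα ihβ => simp [unfoldings, word, ihα, ihβ]
  | star α ih => simp [unfoldings, word, ih]

theorem Formula.length_fischerLadner_le (φ : Formula P A) : φ.fischerLadner.length ≤ φ.length := by
  unfold Formula.length
  induction φ with
  | prop p => rfl
  | neg φ ih => simpa [fischerLadner, word] using ih
  | and φ ψ ihφ ihψ => simpa [fischerLadner, word] using Nat.add_le_add ihφ ihψ
  | dia α φ ih =>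
    simp only [fischerLadner, word, List.length_append, List.length_cons,
      Program.length_unfoldings]
    omega

theorem Program.dia_mem_unfoldings (α : Program A) (ψ : Formula P A) :
    Formula.dia α ψ ∈ α.unfoldings ψ := by
  cases α <;> simp [unfoldings]

end FischerLadner

/-! ### The truth lemma and the finite model property -/

namespace PolyderivativeModel

variable {P : Type u} {A : Type v} (M : PolyderivativeModel.{u, v, w} P A)
  (S : List (Formula P A))

theorem mem_truthSet_dia_of_kripkeRel (hM : M.IsPolytopologicalClosure) {α : Program A}
    {ψ : Formula P A} (hS : α.unfoldings ψ ⊆ S) {q r : M.Filtration S}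
    (hqr : kripkeRel (M.filtrationRel S) α q r) (hr : M.cell S r ⊆ M.truthSet ψ) :
    M.cell S q ⊆ M.truthSet (.dia α ψ) := by
  -- Truth of a formula of `S` is constant on cells, so one witness in a cell suffices.
  have spread {χ : Formula P A} (hχ : χ ∈ S) {q : M.Filtration S} {x : M.X}
      (hx : x ∈ M.cell S q) (h : x ∈ M.truthSet χ) : M.cell S q ⊆ M.truthSet χ := by
    intro y hy
    exact (Quotient.exact (Eq.trans hx (Eq.symm hy)) χ hχ).1 h
  induction α generalizing ψ q r with
  | atom a =>
    obtain ⟨T, hT⟩ := hM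
    induction hqr using ReflTransGen.head_induction_on with
    | refl =>
      refine hr.trans ?_
      change _ ⊆ M.d a _
      rw [hT]
      exact @subset_closure _ (T a) _
    | head h _ ih =>
      obtain ⟨x, hxq, hxr⟩ := h
      refine spread (hS (Program.dia_mem_unfoldings _ _)) hxq ?_
      -- Each further step adds an `a`-closure, which idempotence absorbs.
      have h2 : M.d a _ ⊆ M.d a (M.d a (M.truthSet ψ)) := M.programOp_mono (.atom a) ih
      have h3 := h2 hxr
      rwa [hT, hT, @closure_closure _ (T a), ← hT] at h3
  | comp α β ihα ihβ =>
    obtain ⟨q', h, h'⟩ := hqr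
    simp only [Program.unfoldings, List.cons_subset, List.append_subset] at hS
    exact ihα hS.2.1 h (ihβ hS.2.2 h' hr)
  | union α β ihα ihβ =>
    simp only [Program.unfoldings, List.cons_subset, List.append_subset] at hS
    rcases hqr with h | h
    · exact (ihα hS.2.1 h hr).trans Set.subset_union_left
    · exact (ihβ hS.2.2 h hr).trans Set.subset_union_right
  | star α ih =>
    simp only [Program.unfoldings, List.cons_subset] at hS
    induction hqr using ReflTransGen.head_induction_on with
    | refl => exact hr.trans (M.subset_programOp_star α _)
    | head h _ ih' => exact (ih hS.2 h ih').trans (M.programOp_programOp_star_subset α _)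

theorem mem_truthSet_iff_kripkeSat (hM : M.IsPolytopologicalClosure) {φ : Formula P A}
    (hS : φ.fischerLadner ⊆ S) (x : M.X) :
    x ∈ M.truthSet φ ↔ kripkeSat (M.filtrationRel S)
      (fun p q => M.cell S q ⊆ M.val p) φ ⟦x⟧ := by
  induction φ generalizing x with
  | prop p =>
    refine ⟨fun hx y hy => ?_, fun h => h rfl⟩
    exact (Quotient.exact (Eq.symm hy) (.prop p) (hS (by simp [Formula.fischerLadner]))).1 hx
  | neg φ ih =>
    simp only [Formula.fischerLadner, List.cons_subset] at hS
    exact not_congr (ih hS.2 x)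
  | and φ ψ ihφ ihψ =>
    simp only [Formula.fischerLadner, List.cons_subset, List.append_subset] at hS
    exact and_congr (ihφ hS.2.1 x) (ihψ hS.2.2 x)
  | dia α φ ih =>
    simp only [Formula.fischerLadner, List.append_subset] at hS
    constructor
    · intro hx
      change x ∈ M.programOp α (M.truthSet φ) at hx
      rw [← M.iUnion_inter_cell S (M.truthSet φ), programOp_iUnion] at hx
      obtain ⟨q, hq⟩ := Set.mem_iUnion.1 hx
      refine ⟨q, M.kripkeRel_filtrationRel_of_mem S α
        (M.programOp_mono α Set.inter_subset_right hq), ?_⟩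
      have hne : (M.truthSet φ ∩ M.cell S q).Nonempty := by
        rw [Set.nonempty_iff_ne_empty]
        intro h
        rw [h, programOp_empty] at hq
        exact hq
      obtain ⟨y, hy, rfl⟩ := hne
      exact (ih hS.2 y).1 hy
    · rintro ⟨q, hq, hφ⟩
      refine M.mem_truthSet_dia_of_kripkeRel S hM hS.1 hq ?_ rfl
      rintro y rfl
      exact (ih hS.2 y).2 hφ

/-- Filtration: a formula satisfied in a polytopological closure model is satisfied in a finite
relational model of preorders. -/
theorem exists_kripkeSat (hM : M.IsPolytopologicalClosure) {φ : Formula P A}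
    {x : M.X} (hx : x ∈ M.truthSet φ) :
    ∃ (X : Type w) (R : A → X → X → Prop) (V : P → X → Prop), Finite X ∧
      Nat.card X ≤ 2 ^ φ.length ∧ (∀ a x, R a x x) ∧
      (∀ a x y z, R a x y → R a y z → R a x z) ∧ ∃ x, kripkeSat R V φ x := by
  refine ⟨M.Filtration φ.fischerLadner, _, _, M.finite_filtration _, ?_, ?_, ?_, _,
    (M.mem_truthSet_iff_kripkeSat φ.fischerLadner hM (List.Subset.refl _) x).1 hx⟩
  · exact (M.card_filtration_le _).trans
      (Nat.pow_le_pow_right two_pos φ.length_fischerLadner_le)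
  · exact fun _ _ => ReflTransGen.refl
  · exact fun _ _ _ _ => ReflTransGen.trans

end PolyderivativeModel

theorem primrec_two_pow : Primrec fun n : ℕ => 2 ^ n :=
  (Primrec₂.unpaired'.1 Nat.Primrec.pow).comp (Primrec.const 2) Primrec.id

theorem effectiveFMP (P : Type u) (A : Type v) : EffectiveFMP.{u, v, w} P A := by
  refine ⟨fun n => 2 ^ n, primrec_two_pow.to_comp, ?_⟩
  rintro φ ⟨M, hM, x, hx⟩
  obtain ⟨X, R, V, hfin, hcard, hr, ht, y, hy⟩ := M.exists_kripkeSat hM hx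
  exact ⟨kripkeModel R V, isPolytopologicalClosure_kripkeModel R V, hfin, hcard, y,
    (mem_truthSet_kripkeModel hr ht φ y).2 hy⟩

end TopPDL

namespace TopPDL

open Relation Encodable

/-! ### Primitive recursive predicates and bounded reachability -/

section PrimrecClosure

variable {α : Type*} [Primcodable α]

theorem primrecPred_testBit {f g : α → ℕ} (hf : Primrec f) (hg : Primrec g) :
    PrimrecPred fun a => (f a).testBit (g a) = true :=
  (Primrec.eq.comp (Primrec.nat_mod.comp (Primrec.nat_div.comp hf (primrec_two_pow.comp hg))
    (Primrec.const 2)) (Primrec.const 1)).of_eq fun a => by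
      rw [Nat.testBit_eq_decide_div_mod_eq, decide_eq_true_iff]

theorem primrecPred_imp {p q : α → Prop} (hp : PrimrecPred p) (hq : PrimrecPred q) :
    PrimrecPred fun a => p a → q a :=
  (hp.not.or hq).of_eq fun _ => imp_iff_not_or.symm

theorem primrecPred_forall_lt {f : α → ℕ} {p : α → ℕ → Prop} (hf : Primrec f)
    (hp : PrimrecPred fun x : α × ℕ => p x.1 x.2) : PrimrecPred fun a => ∀ n < f a, p a n := by
  have h : PrimrecRel fun (n : ℕ) (a : α) => p a n := hp.comp (Primrec.snd.pair Primrec.fst)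
  exact (h.forall_mem_list.comp (Primrec.list_range.comp hf) Primrec.id).of_eq fun a => by simp

theorem primrecPred_exists_lt {f : α → ℕ} {p : α → ℕ → Prop} (hf : Primrec f)
    (hp : PrimrecPred fun x : α × ℕ => p x.1 x.2) : PrimrecPred fun a => ∃ n < f a, p a n := by
  have h : PrimrecRel fun (n : ℕ) (a : α) => p a n := hp.comp (Primrec.snd.pair Primrec.fst)
  exact (h.exists_mem_list.comp (Primrec.list_range.comp hf) Primrec.id).of_eq fun a => by simp

theorem primrecPred_mem {β : Type*} [Primcodable β] {f : α → β} {l : α → List β}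
    (hf : Primrec f) (hl : Primrec l) : PrimrecPred fun a => f a ∈ l a :=
  ((Primrec.eq (α := β)).exists_mem_list.comp hl hf).of_eq fun a => by simp

end PrimrecClosure

/-- The relation on `{0, …, N - 1}` with a given defining condition, as a list of pairs. -/
noncomputable def tabulate (N : ℕ) (r : ℕ → ℕ → Prop) : List (ℕ × ℕ) :=
  open Classical in
  (List.range N).flatMap fun i =>
    ((List.range N).map (Prod.mk i)).filter fun x => r x.1 x.2

theorem mem_tabulate {N : ℕ} {r : ℕ → ℕ → Prop} {i j : ℕ} (hi : i < N) (hj : j < N) :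
    (i, j) ∈ tabulate N r ↔ r i j := by
  simp [tabulate, hi, hj]

theorem primrec_tabulate {α : Type*} [Primcodable α] {N : α → ℕ} {r : α → ℕ → ℕ → Prop}
    (hN : Primrec N) (hr : PrimrecPred fun x : α × ℕ × ℕ => r x.1 x.2.1 x.2.2) :
    Primrec fun a => tabulate (N a) (r a) := by
  classical
  have hr' : PrimrecRel fun (x : ℕ × ℕ) (a : α) => r a x.1 x.2 :=
    hr.comp (Primrec.snd.pair Primrec.fst)
  have hmap : Primrec fun x : α × ℕ => (List.range (N x.1)).map (Prod.mk x.2) :=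
    Primrec.list_map (Primrec.list_range.comp (hN.comp Primrec.fst))
      ((Primrec.snd.comp Primrec.fst).pair Primrec.snd)
  exact (Primrec.list_flatMap (Primrec.list_range.comp hN)
    (hr'.listFilter.comp hmap Primrec.fst).to₂).of_eq fun a => by simp [tabulate]

/-- The reflexive transitive closure of a relation on `{0, …, N - 1}`, defined by quantifying over
the binary codes of sets closed under predecessors. -/
def boundedStar (N : ℕ) (r : ℕ → ℕ → Prop) (i j : ℕ) : Prop :=
  ∀ z < 2 ^ N, z.testBit j = true →
    (∀ k < N, ∀ l < N, r k l → z.testBit l = true → z.testBit k = true) → z.testBit i = true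

theorem primrecPred_boundedStar {α : Type*} [Primcodable α] {N i j : α → ℕ}
    {r : α → ℕ → ℕ → Prop} (hN : Primrec N)
    (hr : PrimrecPred fun x : α × ℕ × ℕ => r x.1 x.2.1 x.2.2) (hi : Primrec i) (hj : Primrec j) :
    PrimrecPred fun a => boundedStar (N a) (r a) (i a) (j a) := by
  open Primrec in
  refine primrecPred_forall_lt (primrec_two_pow.comp hN) ?_
  refine primrecPred_imp (primrecPred_testBit snd (hj.comp fst)) ?_
  refine primrecPred_imp ?_ (primrecPred_testBit snd (hi.comp fst))
  refine primrecPred_forall_lt (hN.comp fst) (primrecPred_forall_lt (hN.comp (fst.comp fst)) ?_)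
  refine primrecPred_imp (hr.comp ((fst.comp (fst.comp fst)).pair ((snd.comp fst).pair snd))) ?_
  exact primrecPred_imp (primrecPred_testBit (snd.comp (fst.comp fst)) snd)
    (primrecPred_testBit (snd.comp (fst.comp fst)) (snd.comp fst))

theorem boundedStar_iff {X : Type w} {N : ℕ} (e : X ≃ Fin N) {r : ℕ → ℕ → Prop}
    {r' : X → X → Prop} (h : ∀ x y, r (e x) (e y) ↔ r' x y) (x y : X) :
    boundedStar N r (e x) (e y) ↔ ReflTransGen r' x y := by
  classical
  constructor
  · intro hs
    -- The test set is the set of points from which `y` is reachable; it contains `y` and is closed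
    -- under predecessors.
    have hbit (x : X) : (Nat.ofBits fun i : Fin N => decide (ReflTransGen r' (e.symm i) y)).testBit
        (e x) = true ↔ ReflTransGen r' x y := by
      simp [Nat.testBit_ofBits_lt]
    refine (hbit x).1 (hs _ (Nat.ofBits_lt_two_pow _) ((hbit y).2 ReflTransGen.refl) ?_)
    intro k hk l hl hkl
    obtain ⟨k, rfl⟩ : ∃ k', (e k' : ℕ) = k := ⟨e.symm ⟨k, hk⟩, by simp⟩
    obtain ⟨l, rfl⟩ : ∃ l', (e l' : ℕ) = l := ⟨e.symm ⟨l, hl⟩, by simp⟩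
    rw [hbit, hbit]
    exact ReflTransGen.head ((h k l).1 hkl)
  · intro hxy z _ hy hz
    induction hxy using ReflTransGen.head_induction_on with
    | refl => exact hy
    | head hab _ ih => exact hz _ (e _).2 _ (e _).2 ((h _ _).2 hab) ih

/-! ### Parsing Polish words with a stack of sorts -/

section Evaluation

variable {P : Type u} {A : Type v}

/-- An index distinguishing the kinds of symbols. -/
def symbolKind : Symb P A → ℕ
  | .inl _ => 6
  | .inr (.inl _) => 7
  | .inr (.inr c) => Connective.equivFin c

/-- The sorts (`1` for programs, `2` for formulas) of the arguments of a symbol of a given kind. -/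
def argumentSorts (k : ℕ) : List ℕ :=
  if k = 0 then [2] else if k = 1 then [2, 2] else if k = 2 then [1, 2] else
  if k = 3 then [1, 1] else if k = 4 then [1, 1] else if k = 5 then [1] else []

/-- The sort of the expressions formed with a symbol of a given kind. -/
def resultSort (k : ℕ) : ℕ :=
  if k < 3 then 2 else if k = 6 then 2 else 1

/-- Updates the stack of sorts of the expressions that a word is the concatenation of, when a
symbol is put in front of the word. The sort `0` stands for an ill-formed expression. -/
def sortStep (σ : Symb P A) (st : List ℕ) : List ℕ :=
  if st.take (argumentSorts (symbolKind σ)).length = argumentSorts (symbolKind σ) then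
    resultSort (symbolKind σ) :: st.drop (argumentSorts (symbolKind σ)).length
  else [0]

/-- The sorts of the expressions that a word is the concatenation of. -/
def sorts (s : List (Symb P A)) : List ℕ := s.foldr sortStep []

theorem sorts_program_append (α : Program A) (s : List (Symb P A)) :
    sorts (α.word P ++ s) = 1 :: sorts s := by
  induction α generalizing s with
  | atom a => simp [sorts, Program.word, sortStep, symbolKind, argumentSorts, resultSort]
  | comp α β ihα ihβ =>
    have : sorts (α.word P ++ (β.word P ++ s)) = 1 :: 1 :: sorts s := by rw [ihα, ihβ]
    simp only [sorts, Program.word, List.cons_append, List.append_assoc,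
      List.foldr_cons] at this ⊢
    simp [this, sortStep, symbolKind, argumentSorts, resultSort, Connective.equivFin]
  | union α β ihα ihβ =>
    have : sorts (α.word P ++ (β.word P ++ s)) = 1 :: 1 :: sorts s := by rw [ihα, ihβ]
    simp only [sorts, Program.word, List.cons_append, List.append_assoc,
      List.foldr_cons] at this ⊢
    simp [this, sortStep, symbolKind, argumentSorts, resultSort, Connective.equivFin]
  | star α ih =>
    have : sorts (α.word P ++ s) = 1 :: sorts s := ih s
    simp only [sorts, Program.word, List.cons_append, List.foldr_cons] at this ⊢
    simp [this, sortStep, symbolKind, argumentSorts, resultSort, Connective.equivFin]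

theorem sorts_formula_append (φ : Formula P A) (s : List (Symb P A)) :
    sorts (φ.word ++ s) = 2 :: sorts s := by
  induction φ generalizing s with
  | prop p => simp [sorts, Formula.word, sortStep, symbolKind, argumentSorts, resultSort]
  | neg φ ih =>
    have : sorts (φ.word ++ s) = 2 :: sorts s := ih s
    simp only [sorts, Formula.word, List.cons_append, List.foldr_cons] at this ⊢
    simp [this, sortStep, symbolKind, argumentSorts, resultSort, Connective.equivFin]
  | and φ ψ ihφ ihψ =>
    have : sorts (φ.word ++ (ψ.word ++ s)) = 2 :: 2 :: sorts s := by rw [ihφ, ihψ]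
    simp only [sorts, Formula.word, List.cons_append, List.append_assoc,
      List.foldr_cons] at this ⊢
    simp [this, sortStep, symbolKind, argumentSorts, resultSort, Connective.equivFin]
  | dia α φ ih =>
    have : sorts (α.word P ++ (φ.word ++ s)) = 1 :: 2 :: sorts s := by
      rw [sorts_program_append, ih]
    simp only [sorts, Formula.word, List.cons_append, List.append_assoc,
      List.foldr_cons] at this ⊢
    simp [this, sortStep, symbolKind, argumentSorts, resultSort, Connective.equivFin]

/-- `Decomposes s l`: the word `s` is a concatenation of words of programs and formulas, whose
sorts are listed in `l`. -/
inductive Decomposes : List (Symb P A) → List ℕ → Prop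
  | nil : Decomposes [] []
  | program (α : Program A) {s l} : Decomposes s l → Decomposes (α.word P ++ s) (1 :: l)
  | formula (φ : Formula P A) {s l} : Decomposes s l → Decomposes (φ.word ++ s) (2 :: l)

theorem Decomposes.exists_program {s : List (Symb P A)} {l : List ℕ} (h : Decomposes s (1 :: l)) :
    ∃ (α : Program A) (t : List (Symb P A)), s = α.word P ++ t ∧ Decomposes t l := by
  cases h with
  | program α h => exact ⟨α, _, rfl, h⟩

theorem Decomposes.exists_formula {s : List (Symb P A)} {l : List ℕ} (h : Decomposes s (2 :: l)) :
    ∃ (φ : Formula P A) (t : List (Symb P A)), s = φ.word ++ t ∧ Decomposes t l := by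
  cases h with
  | formula φ h => exact ⟨φ, _, rfl, h⟩

theorem decomposes_sorts (s : List (Symb P A)) (hs : 0 ∉ sorts s) : Decomposes s (sorts s) := by
  induction s with
  | nil => exact .nil
  | cons σ s ih =>
    change 0 ∉ sortStep σ (sorts s) at hs
    change Decomposes (σ :: s) (sortStep σ (sorts s))
    generalize sorts s = l at hs ih
    unfold sortStep at hs ⊢
    split_ifs at hs ⊢ with hl
    · obtain ⟨l, rfl⟩ : ∃ l', l = argumentSorts (symbolKind σ) ++ l' :=
        ⟨_, by conv_lhs => rw [← List.take_append_drop (argumentSorts (symbolKind σ)).length l, hl]⟩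
      -- No argument has sort `0`, so a successful step cannot remove a `0`: its absence now implies
      -- its absence before.
      have h0 : 0 ∉ argumentSorts (symbolKind σ) := by
        unfold argumentSorts
        split_ifs <;> simp
      simp only [List.drop_left, List.mem_cons, not_or, List.mem_append] at hs ih ⊢
      have hd := ih ⟨h0, hs.2⟩
      rcases σ with p | a | c
      · exact .formula (.prop p) hd
      · exact .program (.atom a) hd
      · cases c with
        | neg =>
          obtain ⟨φ, t, rfl, ht⟩ := hd.exists_formula
          exact .formula (.neg φ) ht
        | and =>
          obtain ⟨φ, t, rfl, ht⟩ := hd.exists_formula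
          obtain ⟨ψ, t, rfl, ht'⟩ := ht.exists_formula
          simpa [Formula.word, symbolKind, resultSort, Connective.equivFin] using
            Decomposes.formula (.and φ ψ) ht'
        | dia =>
          obtain ⟨α, t, rfl, ht⟩ := hd.exists_program
          obtain ⟨ψ, t, rfl, ht'⟩ := ht.exists_formula
          simpa [Formula.word, symbolKind, resultSort, Connective.equivFin] using
            Decomposes.formula (.dia α ψ) ht'
        | comp =>
          obtain ⟨α, t, rfl, ht⟩ := hd.exists_program
          obtain ⟨β, t, rfl, ht'⟩ := ht.exists_program
          simpa [Program.word, symbolKind, resultSort, Connective.equivFin] using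
            Decomposes.program (.comp α β) ht'
        | union =>
          obtain ⟨α, t, rfl, ht⟩ := hd.exists_program
          obtain ⟨β, t, rfl, ht'⟩ := ht.exists_program
          simpa [Program.word, symbolKind, resultSort, Connective.equivFin] using
            Decomposes.program (.union α β) ht'
        | star =>
          obtain ⟨α, t, rfl, ht⟩ := hd.exists_program
          exact .program (.star α) ht
    · simp at hs

/-- A word is a formula if and only if its list of sorts is `[2]`. -/
theorem sorts_eq_iff (s : List (Symb P A)) :
    sorts s = [2] ↔ ∃ φ : Formula P A, φ.word = s := by
  constructor
  · intro h
    have hd := decomposes_sorts s (by simp [h])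
    rw [h] at hd
    obtain ⟨φ, t, rfl, ht⟩ := hd.exists_formula
    cases ht
    exact ⟨φ, by simp⟩
  · rintro ⟨φ, rfl⟩
    simpa [sorts] using sorts_formula_append φ []

variable [Primcodable P] [Primcodable A]

/-! ### Evaluating words in coded models -/

/-- The relation on numbers assigned to a symbol by the model coded by `m`. -/
def codedRel (m : ℕ) (σ : Symb P A) (i j : ℕ) : Prop :=
  m.testBit (Nat.pair (encode σ) (Nat.pair i j)) = true

/-- The relation denoted by an expression on the points `{0, …, N - 1}` of the model coded by `m`,
given the head symbol `σ` and the stack of denotations of the expressions that follow. A formula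
denotes the relation `{(i, j) | i satisfies it}`, so that `dia` and `comp` are treated alike. -/
def entry (N m : ℕ) (σ : Symb P A) (st : List (List (ℕ × ℕ))) (i j : ℕ) : Prop :=
  (symbolKind σ = 6 ∧ codedRel m σ i 0) ∨
  (symbolKind σ = 7 ∧ boundedStar N (codedRel m σ) i j) ∨
  (symbolKind σ = 0 ∧ (i, j) ∉ st.headI) ∨
  (symbolKind σ = 1 ∧ (i, j) ∈ st.headI ∧ (i, j) ∈ st.tail.headI) ∨
  ((symbolKind σ = 2 ∨ symbolKind σ = 3) ∧ ∃ k < N, (i, k) ∈ st.headI ∧ (k, j) ∈ st.tail.headI) ∨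
  (symbolKind σ = 4 ∧ ((i, j) ∈ st.headI ∨ (i, j) ∈ st.tail.headI)) ∨
  (symbolKind σ = 5 ∧ boundedStar N (fun k l => (k, l) ∈ st.headI) i j)

/-- Updates the stack of denotations. -/
noncomputable def evalStep (N m : ℕ) (σ : Symb P A) (st : List (List (ℕ × ℕ))) :
    List (List (ℕ × ℕ)) :=
  tabulate N (entry N m σ st) :: st.drop (argumentSorts (symbolKind σ)).length

/-- The denotations of the expressions that a word is the concatenation of, in the model with points
`{0, …, N - 1}` coded by `m`. -/
noncomputable def evalWord (N m : ℕ) (s : List (Symb P A)) : List (List (ℕ × ℕ)) :=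
  s.foldr (evalStep N m) []

section Correctness

variable {X : Type w} {N m : ℕ} (e : X ≃ Fin N) {R : A → X → X → Prop} {V : P → X → Prop}
  {W : List (Symb P A)}

theorem exists_lt_iff_of_equiv {p : ℕ → Prop} : (∃ k < N, p k) ↔ ∃ x, p (e x) := by
  constructor
  · rintro ⟨k, hk, h⟩
    exact ⟨e.symm ⟨k, hk⟩, by simpa using h⟩
  · rintro ⟨x, hx⟩
    exact ⟨_, (e x).2, hx⟩

/-- Agreement with `m` is required only on the symbols of `W`, since a number codes finitely many of
them. The arbitrary tail `s` lets the induction pass through arguments lower on the stack. -/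
theorem evalWord_program_append
    (hR : ∀ a, .inr (.inl a) ∈ W → ∀ x y, R a x y ↔
      ReflTransGen (fun x y => codedRel m (.inr (.inl a) : Symb P A) (e x) (e y)) x y)
    (α : Program A) (hα : α.word P ⊆ W) (s : List (Symb P A)) :
    ∃ t, evalWord N m (α.word P ++ s) = t :: evalWord N m s ∧
      ∀ x y, ((e x : ℕ), (e y : ℕ)) ∈ t ↔ kripkeRel R α x y := by
  induction α generalizing s with
  | atom a =>
    refine ⟨_, rfl, fun x y => ?_⟩
    rw [mem_tabulate (e x).2 (e y).2]
    simp only [Program.word, List.cons_subset] at hα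
    simp only [entry, symbolKind, kripkeRel, hR a hα.1]
    simpa using boundedStar_iff e (fun _ _ => Iff.rfl) x y
  | comp α β ihα ihβ =>
    simp only [Program.word, List.cons_subset, List.append_subset] at hα
    obtain ⟨t₂, h₂, ht₂⟩ := ihβ hα.2.2 s
    obtain ⟨t₁, h₁, ht₁⟩ := ihα hα.2.1 (β.word P ++ s)
    rw [h₂] at h₁
    simp only [evalWord, Program.word, List.cons_append, List.append_assoc,
      List.foldr_cons] at h₁ ⊢
    rw [h₁]
    refine ⟨_, rfl, fun x y => ?_⟩
    rw [mem_tabulate (e x).2 (e y).2]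
    simp [entry, symbolKind, Connective.equivFin, kripkeRel, exists_lt_iff_of_equiv e, ht₁, ht₂]
  | union α β ihα ihβ =>
    simp only [Program.word, List.cons_subset, List.append_subset] at hα
    obtain ⟨t₂, h₂, ht₂⟩ := ihβ hα.2.2 s
    obtain ⟨t₁, h₁, ht₁⟩ := ihα hα.2.1 (β.word P ++ s)
    rw [h₂] at h₁
    simp only [evalWord, Program.word, List.cons_append, List.append_assoc,
      List.foldr_cons] at h₁ ⊢
    rw [h₁]
    refine ⟨_, rfl, fun x y => ?_⟩
    rw [mem_tabulate (e x).2 (e y).2]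
    simp [entry, symbolKind, Connective.equivFin, kripkeRel, ht₁, ht₂]
  | star α ih =>
    simp only [Program.word, List.cons_subset] at hα
    obtain ⟨t, h, ht⟩ := ih hα.2 s
    simp only [evalWord, Program.word, List.cons_append, List.foldr_cons] at h ⊢
    rw [h]
    refine ⟨_, rfl, fun x y => ?_⟩
    rw [mem_tabulate (e x).2 (e y).2]
    simpa [entry, symbolKind, Connective.equivFin, kripkeRel] using boundedStar_iff e ht x y

theorem evalWord_formula_append
    (hR : ∀ a, .inr (.inl a) ∈ W → ∀ x y, R a x y ↔
      ReflTransGen (fun x y => codedRel m (.inr (.inl a) : Symb P A) (e x) (e y)) x y)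
    (hV : ∀ p, .inl p ∈ W → ∀ x, V p x ↔ codedRel m (.inl p : Symb P A) (e x) 0)
    (φ : Formula P A) (hφ : φ.word ⊆ W) (s : List (Symb P A)) :
    ∃ t, evalWord N m (φ.word ++ s) = t :: evalWord N m s ∧
      ∀ x y, ((e x : ℕ), (e y : ℕ)) ∈ t ↔ kripkeSat R V φ x := by
  induction φ generalizing s with
  | prop p =>
    refine ⟨_, rfl, fun x y => ?_⟩
    rw [mem_tabulate (e x).2 (e y).2]
    simp only [Formula.word, List.cons_subset] at hφ
    simp [entry, symbolKind, kripkeSat, hV p hφ.1]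
  | neg φ ih =>
    simp only [Formula.word, List.cons_subset] at hφ
    obtain ⟨t, h, ht⟩ := ih hφ.2 s
    simp only [evalWord, Formula.word, List.cons_append, List.foldr_cons] at h ⊢
    rw [h]
    refine ⟨_, rfl, fun x y => ?_⟩
    rw [mem_tabulate (e x).2 (e y).2]
    simp [entry, symbolKind, Connective.equivFin, kripkeSat, ht]
  | and φ ψ ihφ ihψ =>
    simp only [Formula.word, List.cons_subset, List.append_subset] at hφ
    obtain ⟨t₂, h₂, ht₂⟩ := ihψ hφ.2.2 s
    obtain ⟨t₁, h₁, ht₁⟩ := ihφ hφ.2.1 (ψ.word ++ s)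
    rw [h₂] at h₁
    simp only [evalWord, Formula.word, List.cons_append, List.append_assoc,
      List.foldr_cons] at h₁ ⊢
    rw [h₁]
    refine ⟨_, rfl, fun x y => ?_⟩
    rw [mem_tabulate (e x).2 (e y).2]
    simp [entry, symbolKind, Connective.equivFin, kripkeSat, ht₁, ht₂]
  | dia α φ ih =>
    simp only [Formula.word, List.cons_subset, List.append_subset] at hφ
    obtain ⟨t₂, h₂, ht₂⟩ := ih hφ.2.2 s
    obtain ⟨t₁, h₁, ht₁⟩ := evalWord_program_append e hR α hφ.2.1 (φ.word ++ s)
    rw [h₂] at h₁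
    simp only [evalWord, Formula.word, List.cons_append, List.append_assoc,
      List.foldr_cons] at h₁ ⊢
    rw [h₁]
    refine ⟨_, rfl, fun x y => ?_⟩
    rw [mem_tabulate (e x).2 (e y).2]
    simp [entry, symbolKind, Connective.equivFin, kripkeSat, exists_lt_iff_of_equiv e, ht₁, ht₂]

end Correctness

/-! ### Coding finite models and deciding validity -/

/-- A bound for the bits that determine a model with `N` points on the symbols of a word. -/
def codeBound (s : List (Symb P A)) (N : ℕ) : ℕ :=
  Nat.pair (s.foldr (fun σ n => encode σ + n) 0 + 1) (Nat.pair N N)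

theorem lt_codeBound {s : List (Symb P A)} {σ : Symb P A} (hσ : σ ∈ s) {N i j : ℕ} (hi : i < N)
    (hj : j < N) : Nat.pair (encode σ) (Nat.pair i j) < codeBound s N := by
  have h : encode σ ≤ s.foldr (fun σ n => encode σ + n) 0 := by
    induction s with
    | nil => simp at hσ
    | cons τ s ih =>
      rcases List.mem_cons.1 hσ with rfl | h
      · exact Nat.le_add_right _ _
      · exact (ih h).trans (Nat.le_add_left _ _)
  calc Nat.pair (encode σ) (Nat.pair i j)
      < Nat.pair (encode σ) (Nat.pair N N) :=
        Nat.pair_lt_pair_right _ ((Nat.pair_lt_pair_left _ hi).trans (Nat.pair_lt_pair_right _ hj))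
    _ < codeBound s N := Nat.pair_lt_pair_left _ (Nat.lt_succ_of_le h)

theorem exists_code (s : List (Symb P A)) {N : ℕ} (r : Symb P A → ℕ → ℕ → Prop) :
    ∃ m < 2 ^ codeBound s N, ∀ σ ∈ s, ∀ i < N, ∀ j < N, codedRel m σ i j ↔ r σ i j := by
  classical
  refine ⟨Nat.ofBits fun k : Fin (codeBound s N) => decide (∃ σ : Symb P A,
    decode k.1.unpair.1 = some σ ∧ r σ k.1.unpair.2.unpair.1 k.1.unpair.2.unpair.2),
    Nat.ofBits_lt_two_pow _, fun σ hσ i hi j hj => ?_⟩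
  unfold codedRel
  rw [Nat.testBit_ofBits_lt _ _ (lt_codeBound hσ hi hj)]
  simp only [Nat.unpair_pair, encodek, decide_eq_true_iff]
  simp

/-- The decision procedure. -/
def ValidWord (s : List (Symb P A)) : Prop :=
  sorts s = [2] ∧ ∀ N < 2 ^ (s.length + 1) + 1, ∀ m < 2 ^ codeBound s N, ∀ i < N,
    (i, i) ∈ (evalWord N m s).headI

theorem valid_iff_evalWord (φ : Formula P A) :
    Valid.{u, v, w} φ ↔ ∀ N < 2 ^ (φ.word.length + 1) + 1, ∀ m < 2 ^ codeBound φ.word N, ∀ i < N,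
      (i, i) ∈ (evalWord N m φ.word).headI := by
  constructor
  · intro h N _ m _ i hi
    -- The lift places the coded model in the universe over which `Valid` quantifies.
    let e : ULift.{w} (Fin N) ≃ Fin N := Equiv.ulift
    let R : A → ULift.{w} (Fin N) → ULift.{w} (Fin N) → Prop := fun a =>
      -- A code may give any relation; closing it up makes every code a preorder model.
      ReflTransGen fun x y => codedRel m (.inr (.inl a) : Symb P A) (e x) (e y)
    let V : P → ULift.{w} (Fin N) → Prop := fun p x => codedRel m (.inl p : Symb P A) (e x) 0
    obtain ⟨t, ht, hmem⟩ := evalWord_formula_append e (R := R) (V := V) (W := φ.word) (m := m)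
      (fun _ _ _ _ => Iff.rfl) (fun _ _ _ => Iff.rfl) φ (List.Subset.refl _) []
    rw [List.append_nil] at ht
    rw [ht]
    refine (hmem ⟨⟨i, hi⟩⟩ ⟨⟨i, hi⟩⟩).2 ?_
    exact (mem_truthSet_kripkeModel (R := R) (V := V) (fun _ _ => ReflTransGen.refl)
      (fun _ _ _ _ => ReflTransGen.trans) φ _).1
      (h (kripkeModel R V) (isPolytopologicalClosure_kripkeModel R V) ⟨⟨i, hi⟩⟩)
  · intro h M hM x
    by_contra hx
    -- A countermodel to `φ` is a model of `¬φ`, one symbol longer; hence the exponent `|φ| + 1`.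
    obtain ⟨X, R, V, hfin, hcard, hr, htrans, y, hy⟩ :=
      M.exists_kripkeSat hM (φ := .neg φ) (x := x) hx
    have e := Finite.equivFin X
    obtain ⟨m, hm, hcode⟩ := exists_code φ.word (N := Nat.card X) fun σ i j => match σ with
      | .inl p => ∃ x, (e x : ℕ) = i ∧ V p x
      | .inr (.inl a) => ∃ x y, (e x : ℕ) = i ∧ (e y : ℕ) = j ∧ R a x y
      | .inr (.inr _) => False
    have hinj {x y : X} : (e x : ℕ) = e y ↔ x = y := by rw [Fin.val_inj, e.injective.eq_iff]
    have hR (a) (ha : .inr (.inl a) ∈ φ.word) (x y : X) : R a x y ↔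
        ReflTransGen (fun x y => codedRel m (.inr (.inl a) : Symb P A) (e x) (e y)) x y := by
      have hcoded : (fun x y => codedRel m (.inr (.inl a) : Symb P A) (e x) (e y)) = R a := by
        funext x y
        rw [hcode _ ha _ (e x).2 _ (e y).2]
        simp [hinj]
      rw [hcoded]
      -- `R a` is already a preorder, so closing up its code changes nothing.
      refine ⟨ReflTransGen.single, fun hxy => ?_⟩
      induction hxy with
      | refl => exact hr a x
      | tail _ hbc ih => exact htrans a _ _ _ ih hbc
    have hV (p) (hp : .inl p ∈ φ.word) (x : X) :
        V p x ↔ codedRel m (.inl p : Symb P A) (e x) 0 := by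
      -- Valuations are read in column `0`, a legitimate index because `X` has a point.
      rw [hcode _ hp _ (e x).2 _ (Nat.zero_lt_of_lt (e x).2)]
      simp [hinj]
    obtain ⟨t, ht, hmem⟩ := evalWord_formula_append e hR hV φ (List.Subset.refl _) []
    have hmem' := h _ (Nat.lt_succ_of_le hcard) m hm (e y) (e y).2
    rw [List.append_nil] at ht
    rw [ht] at hmem'
    exact hy ((hmem y y).1 hmem')

theorem validWord_iff (s : List (Symb P A)) :
    ValidWord s ↔ ∃ φ : Formula P A, φ.word = s ∧ Valid.{u, v, w} φ := by
  constructor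
  · rintro ⟨hs, h⟩
    obtain ⟨φ, rfl⟩ := (sorts_eq_iff s).1 hs
    exact ⟨φ, rfl, (valid_iff_evalWord φ).2 h⟩
  · rintro ⟨φ, rfl, h⟩
    exact ⟨(sorts_eq_iff _).2 ⟨φ, rfl⟩, (valid_iff_evalWord φ).1 h⟩

/-! ### Primitive recursiveness of the procedure -/

theorem primrec_symbolKind : Primrec (symbolKind : Symb P A → ℕ) := by
  have hfin : Finite Connective := Finite.of_equiv _ Connective.equivFin.symm
  have hc : Primrec fun c : Connective => (Connective.equivFin c : ℕ) := Primrec.dom_finite _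
  have h : Primrec fun x : A ⊕ Connective =>
      (Sum.casesOn x (fun _ => 7) fun c => Connective.equivFin c : ℕ) :=
    Primrec.sumCasesOn Primrec.id (Primrec₂.const 7) (hc.comp₂ Primrec₂.right)
  refine (Primrec.sumCasesOn (f := (id : Symb P A → Symb P A)) Primrec.id (Primrec₂.const 6)
    (h.comp₂ Primrec₂.right)).of_eq ?_
  rintro (p | a | c) <;> rfl

theorem primrec_argumentSorts : Primrec argumentSorts := by
  have h (n : ℕ) : PrimrecPred fun k : ℕ => k = n := Primrec.eq.comp Primrec.id (Primrec.const n)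
  exact .ite (h 0) (.const _) <| .ite (h 1) (.const _) <| .ite (h 2) (.const _) <|
    .ite (h 3) (.const _) <| .ite (h 4) (.const _) <| .ite (h 5) (.const _) (.const _)

theorem primrec_resultSort : Primrec resultSort :=
  .ite (Primrec.nat_lt.comp Primrec.id (Primrec.const 3)) (.const _) <|
    .ite (Primrec.eq.comp Primrec.id (Primrec.const 6)) (.const _) (.const _)

theorem primrec_sorts : Primrec (sorts : List (Symb P A) → List ℕ) := by
  have hk : Primrec fun x : List (Symb P A) × Symb P A × List ℕ => symbolKind x.2.1 :=
    primrec_symbolKind.comp (Primrec.fst.comp Primrec.snd)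
  have hargs := primrec_argumentSorts.comp hk
  have hst : Primrec fun x : List (Symb P A) × Symb P A × List ℕ => x.2.2 :=
    Primrec.snd.comp Primrec.snd
  have hlen := Primrec.list_length.comp hargs
  refine Primrec.list_foldr (h := fun _ x => sortStep x.1 x.2) Primrec.id
    (Primrec.const ([] : List ℕ)) (Primrec₂.mk ?_)
  exact .ite (Primrec.eq.comp (Primrec.list_take.comp hlen hst) hargs)
    (Primrec.list_cons.comp (primrec_resultSort.comp hk) (Primrec.list_drop.comp hlen hst))
    (.const _)

theorem primrecPred_codedRel {α : Type*} [Primcodable α] {m i j : α → ℕ} {σ : α → Symb P A}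
    (hm : Primrec m) (hσ : Primrec σ) (hi : Primrec i) (hj : Primrec j) :
    PrimrecPred fun a => codedRel (m a) (σ a) (i a) (j a) :=
  primrecPred_testBit hm (Primrec₂.natPair.comp (Primrec.encode.comp hσ)
    (Primrec₂.natPair.comp hi hj))

theorem primrecPred_entry {α : Type*} [Primcodable α] {N m i j : α → ℕ} {σ : α → Symb P A}
    {st : α → List (List (ℕ × ℕ))} (hN : Primrec N) (hm : Primrec m) (hσ : Primrec σ)
    (hst : Primrec st) (hi : Primrec i) (hj : Primrec j) :
    PrimrecPred fun a => entry (N a) (m a) (σ a) (st a) (i a) (j a) := by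
  open Primrec in
  have hk (n : ℕ) : PrimrecPred fun a => symbolKind (σ a) = n :=
    Primrec.eq.comp (primrec_symbolKind.comp hσ) (const n)
  have h₁ : Primrec fun a => (st a).headI := list_headI.comp hst
  have h₂ : Primrec fun a => (st a).tail.headI := list_headI.comp (list_tail.comp hst)
  refine .or (.and (hk 6) (primrecPred_codedRel hm hσ hi (const 0))) ?_
  refine .or (.and (hk 7) (primrecPred_boundedStar hN (primrecPred_codedRel (hm.comp fst)
    (hσ.comp fst) (fst.comp snd) (snd.comp snd)) hi hj)) ?_
  refine .or (.and (hk 0) (primrecPred_mem (hi.pair hj) h₁).not) ?_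
  refine .or (.and (hk 1) (.and (primrecPred_mem (hi.pair hj) h₁)
    (primrecPred_mem (hi.pair hj) h₂))) ?_
  refine .or (.and (.or (hk 2) (hk 3)) (primrecPred_exists_lt hN (.and
    (primrecPred_mem ((hi.comp fst).pair snd) (h₁.comp fst))
    (primrecPred_mem (snd.pair (hj.comp fst)) (h₂.comp fst))))) ?_
  refine .or (.and (hk 4) (.or (primrecPred_mem (hi.pair hj) h₁)
    (primrecPred_mem (hi.pair hj) h₂))) ?_
  exact .and (hk 5) (primrecPred_boundedStar hN (primrecPred_mem snd (h₁.comp fst)) hi hj)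

/-- The fold needs no parsing: on a short stack `headI` returns the empty list. Such values are
harmless, as `ValidWord` rejects ill-formed words through `sorts`. -/
theorem primrec_evalWord {α : Type*} [Primcodable α] {N m : α → ℕ} {s : α → List (Symb P A)}
    (hN : Primrec N) (hm : Primrec m) (hs : Primrec s) :
    Primrec fun a => evalWord (N a) (m a) (s a) := by
  open Primrec in
  refine list_foldr (h := fun a x => evalStep (N a) (m a) x.1 x.2) hs
    (const ([] : List (List (ℕ × ℕ)))) (Primrec₂.mk ?_)
  refine list_cons.comp (primrec_tabulate (hN.comp fst) (primrecPred_entry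
    (hN.comp (fst.comp fst)) (hm.comp (fst.comp fst)) (fst.comp (snd.comp fst))
    (snd.comp (snd.comp fst)) (fst.comp snd) (snd.comp snd))) ?_
  exact list_drop.comp (list_length.comp (primrec_argumentSorts.comp
    (primrec_symbolKind.comp (fst.comp snd)))) (snd.comp snd)

theorem primrec_codeBound {α : Type*} [Primcodable α] {N : α → ℕ} {s : α → List (Symb P A)}
    (hs : Primrec s) (hN : Primrec N) : Primrec fun a => codeBound (s a) (N a) := by
  open Primrec in
  refine Primrec₂.natPair.comp (succ.comp (list_foldr
    (h := fun _ x => encode x.1 + x.2) hs (const 0) (Primrec₂.mk ?_)))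
    (Primrec₂.natPair.comp hN hN)
  exact nat_add.comp (Primrec.encode.comp (fst.comp snd)) (snd.comp snd)

theorem primrecPred_validWord : PrimrecPred (ValidWord : List (Symb P A) → Prop) := by
  open Primrec in
  refine .and (Primrec.eq.comp primrec_sorts (const [2])) ?_
  refine primrecPred_forall_lt (succ.comp (primrec_two_pow.comp (succ.comp list_length))) ?_
  refine primrecPred_forall_lt (primrec_two_pow.comp (primrec_codeBound fst snd)) ?_
  refine primrecPred_forall_lt (snd.comp fst) ?_
  exact primrecPred_mem (snd.pair snd) (list_headI.comp
    (primrec_evalWord (snd.comp (fst.comp fst)) (snd.comp fst) (fst.comp (fst.comp fst))))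

theorem validityDecidable : ValidityDecidable.{u, v, w} P A :=
  (primrecPred_validWord.of_eq validWord_iff).computablePred

end Evaluation

end TopPDL

theorem theorem1 (P : Type u) (A : Type v) :
    TopPDL.EffectiveFMP.{u, v, w} P A ∧
      ∀ [Primcodable P] [Primcodable A], TopPDL.ValidityDecidable.{u, v, w} P A :=
  ⟨TopPDL.effectiveFMP P A, TopPDL.validityDecidable⟩
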